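/- For a complex-valued $f\in C^\infty_c(\mathbb R)$ put $f_K=\sum_{k=0}^{K}\frac{f^{(2k)}}{k!}$, $K\in\mathbb N$. A sequence $(u_K)$ converges to $g$ in $L^1_{loc}(\mathbb R)$ if $g$ is locally integrable and $\int_I|u_K-g|\,dx\to0$ for every compact interval $I$. A weight is a measurable function $\omega:\mathbb R\to\mathbb R$ that is positive almost everywhere. For $1\le p<\infty$ let $L^p(\omega\,dx)$ have the norm $\left(\int|u|^p\,\omega\,dx\right)^{1/p}$, and let $L^\infty_\omega$ have the norm $\operatorname{ess\,sup}|u|\,\omega$. The weight is called admissible for $L^p(\omega\,dx)$ if $\omega^{-1/p}\in L^{p'}(I)$ for every compact interval $I$, where $\frac1p+\frac1{p'}=1$, and admissible for $L^\infty_\omega$ if $\omega^{-1}\in L^1(I)$ for every compact interval $I$. (a) If $f\in C^\infty_c(\mathbb R)$ is not identically zero, then the sequence $(f_K)$ does not converge in $L^1_{loc}(\mathbb R)$; it does not converge in $L^p(\omega\,dx)$ for any $1\le p<\infty$ and any weight admissible for that space; and it does not converge in $L^\infty_\omega$ for any weight admissible for that space. (b) Consequently $e^{(d/dx)^2}$ cannot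 be defined by its power series on $C^\infty_c(\mathbb R)$, neither in $L^1_{loc}(\mathbb R)$ nor in any of the weighted spaces of (a): if $X$ is one of these spaces, there is no map $T:C^\infty_c(\mathbb R)\to X$ such that $f_K\to Tf$ in $X$ for every $f\in C^\infty_c(\mathbb R)$. -/

import Mathlib

open MeasureTheory Filter Topology Set
open scoped ENNReal ContDiff Nat

noncomputable section

namespace HeatSeries

/-- Membership in `C^∞_c(ℝ)`, for complex-valued functions on the line. -/
def IsTestFun (f : ℝ → ℂ) : Prop :=
  ContDiff ℝ ∞ f ∧ HasCompactSupport f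

/-- The partial sum `f_K = ∑_{k ≤ K} f^{(2k)} / k!` of the power series of `e^{(d/dx)²}`
applied to `f`. -/
def partialSum (f : ℝ → ℂ) (K : ℕ) (x : ℝ) : ℂ :=
  ∑ k ∈ Finset.range (K + 1), iteratedDeriv (2 * k) f x / (k ! : ℂ)

/-- `u K → g` in `L¹_loc(ℝ)`: the limit `g` is locally integrable, and on every compact interval
the `L¹` distance from `u K` to `g` tends to zero. -/
def TendstoL1loc (u : ℕ → ℝ → ℂ) (g : ℝ → ℂ) : Prop :=
  LocallyIntegrable g volume ∧
    ∀ a b : ℝ, Tendsto (fun K => ∫⁻ x in Icc a b, ‖u K x - g x‖ₑ) atTop (𝓝 0)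

/-- The measure `w(x) dx`. -/
def weightMeasure (w : ℝ → ℝ) : Measure ℝ :=
  volume.withDensity fun x => ENNReal.ofReal (w x)

/-- `u K → g` in the weighted space `L^p(w dx)`, with norm `(∫ |u|^p w dx)^{1/p}`; used for
`1 ≤ p < ∞`. -/
def TendstoWeightedLp (p : ℝ≥0∞) (w : ℝ → ℝ) (u : ℕ → ℝ → ℂ) (g : ℝ → ℂ) : Prop :=
  MemLp g p (weightMeasure w) ∧
    Tendsto (fun K => eLpNorm (fun x => u K x - g x) p (weightMeasure w)) atTop (𝓝 0)

/-- `u K → g` in the weighted space `L^∞_w`, with norm `ess sup |u| w`. The choice `w = 1` gives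
the usual `L^∞(ℝ)`. -/
def TendstoWeightedLinfty (w : ℝ → ℝ) (u : ℕ → ℝ → ℂ) (g : ℝ → ℂ) : Prop :=
  MemLp (fun x => (w x : ℂ) * g x) ⊤ volume ∧
    Tendsto (fun K => eLpNorm (fun x => (w x : ℂ) * (u K x - g x)) ⊤ volume) atTop (𝓝 0)

/-- The weights for which Hölder's inequality applies on compact intervals to
`|u| = (|u| w^{1/p}) w^{-1/p}`: measurable, almost everywhere positive, and with `w^{-1/p}` in
`L^{p'}_loc`, where `p'` is the exponent conjugate to `p`; used for `1 ≤ p < ∞`. -/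
structure IsLpWeight (p : ℝ≥0∞) (w : ℝ → ℝ) : Prop where
  aemeasurable : AEMeasurable w volume
  pos : ∀ᵐ x : ℝ, 0 < w x
  memLp_inv : ∀ a b : ℝ,
    MemLp (fun x => w x ^ (-(1 / p.toReal))) (ENNReal.conjExponent p) (volume.restrict (Icc a b))

/-- The corresponding weights for the norm `ess sup |u| w`: measurable, almost everywhere positive,
and with `1 / w` in `L¹_loc`. -/
structure IsLinftyWeight (w : ℝ → ℝ) : Prop where
  aemeasurable : AEMeasurable w volume
  pos : ∀ᵐ x : ℝ, 0 < w x
  integrable_inv : ∀ a b : ℝ, IntegrableOn (fun x => (w x)⁻¹) (Icc a b) volume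

end HeatSeries

end

namespace HeatSeries

/-! Convergence in `L¹` on compact intervals forces the terms `f^{(2K+2)}/(K+1)!` to tend to zero
there. Integrating from a point `a` left of the support then gives `|f^{(2K+1)}| ≤ (K+1)!` on `[a,
x]` for large `K`. This growth, about `(n/2)!` for the derivative of order `n`, is so slow that the
Taylor remainders at `a` tend to zero; as all derivatives vanish at `a`, so does `f x`
(`eq_zero_of_tendsto`).

In the weighted spaces, admissibility is what Hölder's inequality needs to bound the `L¹` norm on
compact intervals (`lintegral_enorm_le_eLpNorm_mul`), so they reduce to the same case. -/

theorem factorial_mul_self_le_factorial_two_mul (n : ℕ) : n ! * n ! ≤ (2 * n)! := by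
  rw [two_mul]
  exact Nat.le_of_dvd (Nat.factorial_pos _) (Nat.factorial_mul_factorial_dvd_factorial_add n n)

/-- Since `(2K)! ≥ K!²`, one factor `K!` survives in the denominator after cancelling, and it beats
`K + 1 ≤ 2^K` times any geometric growth. -/
theorem tendsto_factorial_mul_pow_div_factorial (L : ℝ) (hL : 0 ≤ L) :
    Tendsto (fun K : ℕ => ((K + 1)! : ℝ) * L ^ (2 * K + 1) / (2 * K)!) atTop (𝓝 0) := by
  have h := (FloorSemiring.tendsto_pow_div_factorial_atTop (2 * L ^ 2)).const_mul L
  rw [mul_zero] at h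
  refine squeeze_zero (fun K => by positivity) (fun K => ?_) h
  have h1 : (K ! : ℝ) * K ! ≤ (2 * K)! := mod_cast factorial_mul_self_le_factorial_two_mul K
  have h2 : ((K + 1 : ℕ) : ℝ) ≤ 2 ^ K := mod_cast Nat.lt_two_pow_self (n := K)
  have hK : (0 : ℝ) < K ! := mod_cast Nat.factorial_pos K
  calc ((K + 1)! : ℝ) * L ^ (2 * K + 1) / (2 * K)!
      ≤ ((K + 1)! : ℝ) * L ^ (2 * K + 1) / (K ! * K !) := by gcongr
    _ = ((K + 1 : ℕ) : ℝ) * L ^ (2 * K + 1) / K ! := by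
        rw [Nat.factorial_succ]; push_cast; field_simp
    _ ≤ 2 ^ K * L ^ (2 * K + 1) / K ! := by gcongr
    _ = L * ((2 * L ^ 2) ^ K / K !) := by rw [mul_pow, ← pow_mul]; ring

theorem continuous_partialSum {f : ℝ → ℂ} (hf : ContDiff ℝ ∞ f) (K : ℕ) :
    Continuous (partialSum f K) := by
  unfold partialSum
  refine continuous_finsetSum _ fun k _ => ?_
  exact ((contDiff_infty.1 hf (2 * k)).continuous_iteratedDeriv' _).div_const _

/-- A smooth function that vanishes to infinite order at `a`, and whose odd derivatives satisfy
`|f^{(2K+1)}| ≤ (K+1)!` on `[a, x]` for large `K`, vanishes at `x`. -/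
theorem eq_zero_of_eventually_iteratedDeriv_le {f : ℝ → ℂ} (hf : ContDiff ℝ ∞ f) {a x : ℝ}
    (hax : a < x) (h0 : ∀ n, iteratedDeriv n f a = 0)
    (hb : ∀ᶠ K : ℕ in atTop, ∀ y ∈ Icc a x, ‖iteratedDeriv (2 * K + 1) f y‖ ≤ (K + 1)!) :
    f x = 0 := by
  have hW : ∀ n : ℕ, ∀ y ∈ Icc a x, iteratedDerivWithin n f (Icc a x) y = iteratedDeriv n f y :=
    fun n y hy => iteratedDerivWithin_eq_iteratedDeriv (uniqueDiffOn_Icc hax)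
      (contDiff_infty.1 hf n).contDiffAt hy
  have hle : ∀ᶠ K : ℕ in atTop,
      ‖f x‖ ≤ ((K + 1)! : ℝ) * (x - a) ^ (2 * K + 1) / (2 * K)! := by
    filter_upwards [hb] with K hK
    have ht := taylor_mean_remainder_bound (n := 2 * K) (C := ((K + 1)! : ℝ)) hax.le
      (mod_cast (contDiff_infty.1 hf (2 * K + 1)).contDiffOn) (right_mem_Icc.2 hax.le)
      (fun y hy => by rw [hW _ y hy]; exact hK y hy)
    have hz : taylorWithinEval f (2 * K) (Icc a x) a x = 0 := by
      rw [taylor_within_apply]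
      refine Finset.sum_eq_zero fun k _ => ?_
      rw [hW _ a (left_mem_Icc.2 hax.le), h0, smul_zero]
    rwa [hz, sub_zero] at ht
  have := ge_of_tendsto
    (tendsto_factorial_mul_pow_div_factorial (x - a) (sub_nonneg.2 hax.le)) hle
  exact norm_le_zero_iff.1 this

/-- The sup norm of a function vanishing at `a` is at most the `L¹` norm of its derivative. -/
theorem enorm_le_lintegral_enorm_deriv {F : ℝ → ℂ} (hF : ContDiff ℝ 1 F) {a x y : ℝ}
    (h0 : F a = 0) (hy : y ∈ Icc a x) : ‖F y‖ₑ ≤ ∫⁻ t in Icc a x, ‖deriv F t‖ₑ := by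
  have hc : Continuous (deriv F) := hF.continuous_deriv le_rfl
  have h : ∫ t in a..y, deriv F t = F y := by
    rw [intervalIntegral.integral_deriv_eq_sub
      (fun t _ => (hF.differentiable one_ne_zero).differentiableAt) (hc.intervalIntegrable _ _),
      h0, sub_zero]
  rw [← h, intervalIntegral.integral_of_le hy.1]
  refine (enorm_integral_le_lintegral_enorm _).trans (lintegral_mono_set ?_)
  exact fun t ht => ⟨ht.1.le, ht.2.trans hy.2⟩

/-- If the partial sums converge in `L¹` on `s`, the terms of the series tend to zero there. -/
theorem tendsto_lintegral_term {f : ℝ → ℂ} (hf : ContDiff ℝ ∞ f) {g : ℝ → ℂ}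
    (hg : AEStronglyMeasurable g volume) {s : Set ℝ}
    (h : Tendsto (fun K => ∫⁻ x in s, ‖partialSum f K x - g x‖ₑ) atTop (𝓝 0)) :
    Tendsto (fun K : ℕ => ∫⁻ x in s,
      ‖iteratedDeriv (2 * (K + 1)) f x / ((K + 1)! : ℂ)‖ₑ) atTop (𝓝 0) := by
  -- Each term is a difference of two consecutive errors, in which `g` cancels.
  have h2 := ((tendsto_add_atTop_iff_nat 1).2 h).add h
  rw [add_zero] at h2
  refine tendsto_of_tendsto_of_tendsto_of_le_of_le tendsto_const_nhds h2
    (fun _ => zero_le) fun K => ?_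
  have hm : AEMeasurable (fun x => ‖partialSum f (K + 1) x - g x‖ₑ) (volume.restrict s) :=
    ((continuous_partialSum hf _).aestronglyMeasurable.sub hg.restrict).enorm
  beta_reduce
  rw [← lintegral_add_left' hm]
  refine lintegral_mono fun x => ?_
  have : iteratedDeriv (2 * (K + 1)) f x / ((K + 1)! : ℂ)
      = (partialSum f (K + 1) x - g x) - (partialSum f K x - g x) := by
    rw [sub_sub_sub_cancel_right, partialSum, partialSum, Finset.sum_range_succ _ (K + 1),
      add_sub_cancel_left]
  rw [this]
  exact enorm_sub_le

/-- Convergence in `L¹` on compact intervals forces a test function to vanish. -/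
theorem eq_zero_of_tendsto {f : ℝ → ℂ} (hf : IsTestFun f) {g : ℝ → ℂ}
    (hg : AEStronglyMeasurable g volume)
    (h : ∀ a b : ℝ, Tendsto (fun K => ∫⁻ x in Icc a b, ‖partialSum f K x - g x‖ₑ) atTop (𝓝 0)) :
    f = 0 := by
  obtain ⟨hs, hc⟩ := hf
  funext x
  obtain ⟨m, hm⟩ := hc.isCompact.bddBelow
  -- Subtracting 1 puts `a` strictly left of both the support and `x`, so `f` vanishes near `a`,
  -- wherever `x` lies.
  set a := min m x - 1 with ha
  have hax : a < x := by linarith [min_le_right m x]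
  have ham : a < m := by linarith [min_le_left m x]
  have hnear : f =ᶠ[𝓝 a] fun _ => 0 := by
    filter_upwards [Iio_mem_nhds ham] with y hy
    exact image_eq_zero_of_notMem_tsupport fun hy' => absurd (hm hy') (not_le.2 hy)
  have h0 : ∀ n, iteratedDeriv n f a = 0 := fun n => by
    rw [hnear.iteratedDeriv_eq, iteratedDeriv_fun_const_zero]
  refine eq_zero_of_eventually_iteratedDeriv_le hs hax h0 ?_
  filter_upwards [(tendsto_lintegral_term hs hg (h a x)).eventually_le_const one_pos] with K hK y hy
  have h1 : ContDiff ℝ 1 (iteratedDeriv (2 * K + 1) f) := by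
    rw [iteratedDeriv_eq_iterate]
    exact ContDiff.iterate_deriv' 1 (2 * K + 1)
      (mod_cast contDiff_infty.1 hs (1 + (2 * K + 1)))
  have h2 := enorm_le_lintegral_enorm_deriv h1 (h0 _) hy
  rw [← iteratedDeriv_succ] at h2
  have hfac : ‖((K + 1)! : ℂ)‖ₑ = ENNReal.ofReal ((K + 1)! : ℝ) := by
    rw [← ofReal_norm, Complex.norm_natCast]
  have hne : ((K + 1)! : ℂ) ≠ 0 := mod_cast Nat.factorial_ne_zero _
  have h3 : ∫⁻ t in Icc a x, ‖iteratedDeriv (2 * K + 1 + 1) f t‖ₑ ≤ ‖((K + 1)! : ℂ)‖ₑ := by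
    calc ∫⁻ t in Icc a x, ‖iteratedDeriv (2 * K + 1 + 1) f t‖ₑ
        = ∫⁻ t in Icc a x, ‖((K + 1)! : ℂ)‖ₑ *
            ‖iteratedDeriv (2 * (K + 1)) f t / ((K + 1)! : ℂ)‖ₑ := by
          refine lintegral_congr fun t => ?_
          rw [← enorm_mul, mul_div_cancel₀ _ hne]
          rfl
      _ ≤ ‖((K + 1)! : ℂ)‖ₑ * 1 := by
          rw [lintegral_const_mul' _ _ enorm_ne_top]
          gcongr
      _ = _ := mul_one _
  have h4 := h2.trans h3
  rw [hfac, ← ofReal_norm] at h4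
  exact (ENNReal.ofReal_le_ofReal_iff (by positivity)).1 h4

/-- Hölder for `h = v⁻¹ (v h)`. Keeping the weight as a multiplier serves both scales: `v = w^{1/p}`
for finite `p`, and `v = w` for `p = ∞`. -/
theorem lintegral_enorm_le_eLpNorm_mul {p q : ℝ≥0∞} [ENNReal.HolderConjugate p q] {v : ℝ → ℝ}
    (hv : AEMeasurable v volume) (hv0 : ∀ᵐ x, v x ≠ 0) {h : ℝ → ℂ}
    (hh : AEStronglyMeasurable h volume) (s : Set ℝ) :
    ∫⁻ x in s, ‖h x‖ₑ ≤ eLpNorm (fun x => (v x)⁻¹) q (volume.restrict s) *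
      eLpNorm (fun x => (v x : ℂ) * h x) p volume := by
  have hm : AEStronglyMeasurable (fun x => (v x : ℂ) * h x) volume :=
    (Complex.measurable_ofReal.comp_aemeasurable hv).aestronglyMeasurable.mul hh
  have := eLpNorm_smul_le_mul_eLpNorm (p := q) (q := p) (r := 1) (μ := volume.restrict s)
    hm.restrict hv.inv.aestronglyMeasurable.restrict
  refine le_trans (le_of_eq ?_) (this.trans ?_)
  · rw [eLpNorm_one_eq_lintegral_enorm]
    refine lintegral_congr_ae ?_
    filter_upwards [ae_restrict_of_ae hv0] with x hx
    have hx' : (v x : ℂ) ≠ 0 := mod_cast hx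
    simp [Complex.real_smul, hx']
  · exact mul_le_mul_right (eLpNorm_mono_measure _ Measure.restrict_le_self) _

theorem tendsto_lintegral_of_tendsto_eLpNorm {p q : ℝ≥0∞} [ENNReal.HolderConjugate p q]
    {v : ℝ → ℝ} (hv : AEMeasurable v volume) (hv0 : ∀ᵐ x, v x ≠ 0) {u : ℕ → ℝ → ℂ} {g : ℝ → ℂ}
    (hu : ∀ K, AEStronglyMeasurable (u K) volume) (hg : AEStronglyMeasurable g volume) {s : Set ℝ}
    (hs : eLpNorm (fun x => (v x)⁻¹) q (volume.restrict s) ≠ ⊤)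
    (h : Tendsto (fun K => eLpNorm (fun x => (v x : ℂ) * (u K x - g x)) p volume) atTop (𝓝 0)) :
    Tendsto (fun K => ∫⁻ x in s, ‖u K x - g x‖ₑ) atTop (𝓝 0) := by
  have h2 := ENNReal.Tendsto.const_mul h (Or.inr hs)
  rw [mul_zero] at h2
  exact tendsto_of_tendsto_of_tendsto_of_le_of_le tendsto_const_nhds h2
    (fun _ => zero_le) fun K => lintegral_enorm_le_eLpNorm_mul hv hv0 ((hu K).sub hg) s

/-- Needed because a limit in `L^p(w dx)` is a priori measurable only with respect to the weighted
measure. -/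
theorem volume_absolutelyContinuous_weightMeasure {w : ℝ → ℝ} (hw : AEMeasurable w volume)
    (hpos : ∀ᵐ x : ℝ, 0 < w x) : volume ≪ weightMeasure w := by
  refine withDensity_absolutelyContinuous' hw.ennreal_ofReal ?_
  filter_upwards [hpos] with x hx
  simpa using hx

theorem eLpNorm_weightMeasure {p : ℝ≥0∞} (hp : p ≠ 0) (hp' : p ≠ ⊤) {w : ℝ → ℝ}
    (hw : AEMeasurable w volume) (hpos : ∀ᵐ x : ℝ, 0 < w x) {h : ℝ → ℂ}
    (hh : AEStronglyMeasurable h volume) :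
    eLpNorm h p (weightMeasure w)
      = eLpNorm (fun x => ((w x ^ (1 / p.toReal) : ℝ) : ℂ) * h x) p volume := by
  have hp0 : 0 < p.toReal := ENNReal.toReal_pos hp hp'
  rw [eLpNorm_eq_lintegral_rpow_enorm_toReal hp hp', eLpNorm_eq_lintegral_rpow_enorm_toReal hp hp',
    weightMeasure, lintegral_withDensity_eq_lintegral_mul₀ hw.ennreal_ofReal
      (hh.enorm.pow_const _)]
  congr 1
  refine lintegral_congr_ae ?_
  filter_upwards [hpos] with x hx
  have hx' : ‖((w x ^ (1 / p.toReal) : ℝ) : ℂ)‖ₑ = ENNReal.ofReal (w x) ^ (1 / p.toReal) := by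
    rw [← ofReal_norm, Complex.norm_real, Real.norm_of_nonneg (by positivity),
      ENNReal.ofReal_rpow_of_pos hx]
  rw [enorm_mul, ENNReal.mul_rpow_of_nonneg _ _ hp0.le, hx', ← ENNReal.rpow_mul,
    one_div_mul_cancel hp0.ne', ENNReal.rpow_one]
  rfl

theorem not_tendstoL1loc {f : ℝ → ℂ} (hf : IsTestFun f) (hf0 : f ≠ 0) (g : ℝ → ℂ) :
    ¬ TendstoL1loc (partialSum f) g := fun h =>
  hf0 (eq_zero_of_tendsto hf h.1.aestronglyMeasurable h.2)

theorem not_tendstoWeightedLp {f : ℝ → ℂ} (hf : IsTestFun f) (hf0 : f ≠ 0) {p : ℝ≥0∞} {w : ℝ → ℝ}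
    (hp1 : 1 ≤ p) (hp : p ≠ ⊤) (hw : IsLpWeight p w) (g : ℝ → ℂ) :
    ¬ TendstoWeightedLp p w (partialSum f) g := fun h => by
  have hp0 : p ≠ 0 := (one_pos.trans_le hp1).ne'
  have : ENNReal.HolderConjugate p (ENNReal.conjExponent p) := .conjExponent hp1
  have hg : AEStronglyMeasurable g volume :=
    h.1.1.mono_ac (volume_absolutelyContinuous_weightMeasure hw.aemeasurable hw.pos)
  have hu : ∀ K, AEStronglyMeasurable (partialSum f K) volume := fun K =>
    (continuous_partialSum hf.1 K).aestronglyMeasurable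
  refine hf0 (eq_zero_of_tendsto hf hg fun a b => ?_)
  refine tendsto_lintegral_of_tendsto_eLpNorm (p := p) (q := ENNReal.conjExponent p)
    (v := fun x => w x ^ (1 / p.toReal)) (hw.aemeasurable.pow_const _) ?_ hu hg ?_ ?_
  · filter_upwards [hw.pos] with x hx
    exact (Real.rpow_pos_of_pos hx _).ne'
  · refine ne_of_eq_of_ne (eLpNorm_congr_ae ?_) (hw.memLp_inv a b).2.ne
    filter_upwards [ae_restrict_of_ae hw.pos] with x hx
    rw [Real.rpow_neg hx.le]
  · refine h.2.congr fun K => ?_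
    exact eLpNorm_weightMeasure hp0 hp hw.aemeasurable hw.pos ((hu K).sub hg)

theorem not_tendstoWeightedLinfty {f : ℝ → ℂ} (hf : IsTestFun f) (hf0 : f ≠ 0) {w : ℝ → ℝ}
    (hw : IsLinftyWeight w) (g : ℝ → ℂ) :
    ¬ TendstoWeightedLinfty w (partialSum f) g := fun h => by
  have hw0 : ∀ᵐ x, w x ≠ 0 := hw.pos.mono fun _ hx => hx.ne'
  -- Only `w g` is known to be measurable; `g` is recovered as `w⁻¹ (w g)`.
  have hg : AEStronglyMeasurable g volume := by
    refine ((Complex.measurable_ofReal.comp_aemeasurable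
      hw.aemeasurable.inv).aestronglyMeasurable.mul h.1.1).congr ?_
    filter_upwards [hw0] with x hx
    have hx' : (w x : ℂ) ≠ 0 := mod_cast hx
    simp [hx']
  refine hf0 (eq_zero_of_tendsto hf hg fun a b => ?_)
  refine tendsto_lintegral_of_tendsto_eLpNorm (p := ⊤) (q := 1) hw.aemeasurable hw0
    (fun K => (continuous_partialSum hf.1 K).aestronglyMeasurable) hg ?_ h.2
  exact (memLp_one_iff_integrable.2 (hw.integrable_inv a b)).2.ne

theorem exists_isTestFun_ne_zero : ∃ f : ℝ → ℂ, IsTestFun f ∧ f ≠ 0 := by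
  let b : ContDiffBump (0 : ℝ) := ⟨1, 2, one_pos, one_lt_two⟩
  refine ⟨fun x => (b x : ℂ), ⟨Complex.ofRealCLM.contDiff.comp b.contDiff,
    b.hasCompactSupport.comp_left Complex.ofReal_zero⟩, fun h => ?_⟩
  have h0 := congrFun h 0
  rw [b.one_of_mem_closedBall (Metric.mem_closedBall_self zero_le_one)] at h0
  simp at h0

end HeatSeries

theorem mainTheorem9 :
    -- divergence for every single nonzero test function
    (∀ f : ℝ → ℂ, HeatSeries.IsTestFun f → f ≠ 0 →
      (¬ ∃ g : ℝ → ℂ, HeatSeries.TendstoL1loc (HeatSeries.partialSum f) g) ∧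
      (∀ (p : ℝ≥0∞) (w : ℝ → ℝ), 1 ≤ p → p ≠ ⊤ → HeatSeries.IsLpWeight p w →
        ¬ ∃ g : ℝ → ℂ, HeatSeries.TendstoWeightedLp p w (HeatSeries.partialSum f) g) ∧
      (∀ w : ℝ → ℝ, HeatSeries.IsLinftyWeight w →
        ¬ ∃ g : ℝ → ℂ, HeatSeries.TendstoWeightedLinfty w (HeatSeries.partialSum f) g)) ∧
    -- the power series defines no operator on the space of test functions
    (¬ ∃ T : (ℝ → ℂ) → (ℝ → ℂ), ∀ f : ℝ → ℂ, HeatSeries.IsTestFun f →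
        HeatSeries.TendstoL1loc (HeatSeries.partialSum f) (T f)) ∧
    (∀ (p : ℝ≥0∞) (w : ℝ → ℝ), 1 ≤ p → p ≠ ⊤ → HeatSeries.IsLpWeight p w →
      ¬ ∃ T : (ℝ → ℂ) → (ℝ → ℂ), ∀ f : ℝ → ℂ, HeatSeries.IsTestFun f →
        HeatSeries.TendstoWeightedLp p w (HeatSeries.partialSum f) (T f)) ∧
    (∀ w : ℝ → ℝ, HeatSeries.IsLinftyWeight w →
      ¬ ∃ T : (ℝ → ℂ) → (ℝ → ℂ), ∀ f : ℝ → ℂ, HeatSeries.IsTestFun f →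
        HeatSeries.TendstoWeightedLinfty w (HeatSeries.partialSum f) (T f)) := by

  obtain ⟨f, hf, hf0⟩ := HeatSeries.exists_isTestFun_ne_zero
  refine ⟨fun f hf hf0 => ⟨fun ⟨g, hg⟩ => HeatSeries.not_tendstoL1loc hf hf0 g hg,
    fun p w hp1 hp hw ⟨g, hg⟩ => HeatSeries.not_tendstoWeightedLp hf hf0 hp1 hp hw g hg,
    fun w hw ⟨g, hg⟩ => HeatSeries.not_tendstoWeightedLinfty hf hf0 hw g hg⟩,
    fun ⟨T, hT⟩ => HeatSeries.not_tendstoL1loc hf hf0 _ (hT f hf),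
    fun p w hp1 hp hw ⟨T, hT⟩ =>
      HeatSeries.not_tendstoWeightedLp hf hf0 hp1 hp hw _ (hT f hf),
    fun w hw ⟨T, hT⟩ => HeatSeries.not_tendstoWeightedLinfty hf hf0 hw _ (hT f hf)⟩
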